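/- Let $G$ be a countable (discrete) group that is residually amenable, i.e. there is a sequence $G_0\supseteq G_1\supseteq G_2\supseteq\cdots$ of normal subgroups of $G$ with $\bigcap_n G_n=\{e\}$ and every quotient $G/G_n$ amenable. A box family of $G$ is the sequence of metric spaces $\{(G/G_n,d_n)\}_{n\in\mathbb N}$ determined by such a sequence $(G_n)$ and by a proper length function $l:G\to[0,\infty)$ (that is, $l(g)=0$ iff $g=e$, $l(g^{-1})=l(g)$, $l(gh)\le l(g)+l(h)$, and $\{g: l(g)\le R\}$ is finite for every $R$), where $d_n([g],[h])=\inf\{l(g^{-1}hk):k\in G_n\}$. A family $\mathscr X=(X_i)_{i}$ of disjoint metric spaces admits a fibred cofinitely-coarse embedding into a metric space $Y$ if there are metric spaces $(Y_x)_{x\in\bigcup\mathscr X}$, each isometric to $Y$, points $s(x)\in Y_x$, and non-decreasing functions $\rho_1,\rho_2:[0,\infty)\to\mathbb R$ with $\lim_{r\to\infty}\rho_j(r)=\infty$ $(j=1,2)$ such that for every $r>0$ there are a finite set $K_r$ of indices and, for every $i\notin K_r$, every $C\subseteq X_i$ of diameter less than $r$ and every $x\in C$, a bijective isometry $t_C(x):Y_x\to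 Y$ satisfying: (i) $\rho_1(d(x,x'))\le d_Y\big(t_C(x)(s(x)),t_C(x')(s(x'))\big)\le\rho_2(d(x,x'))$ for all $x,x'\in C$; (ii) for all $i\notin K_r$ and all $C_1,C_2\subseteq X_i$ of diameter less than $r$ with $C_1\cap C_2\neq\varnothing$ there is an isometry $t_{C_1C_2}:Y\to Y$ with $t_{C_1}(x)\circ t_{C_2}(x)^{-1}=t_{C_1C_2}$ for all $x\in C_1\cap C_2$. An isometric affine action of $G$ on a real Banach space $B$ is a homomorphism $\alpha$ from $G$ to the group of bijective affine isometries of $B$; it is proper if $\{g\in G:\alpha(g)\xi\in A\}$ is finite for every $\xi\in B$ and every bounded $A\subseteq B$. Theorem. The following are equivalent: (a) $G$ admits a proper isometric affine action on some uniformly convex Banach space; (b) some box family of $G$ admits a fibred cofinitely-coarse embedding into some uniformly convex Banach space; (c) every box family of $G$ admits a fibred cofinitely-coarse embedding into some uniformly convex Banach space. -/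

import Mathlib

universe u v w

/-- A (discrete) group is amenable if it carries a finitely additive probability measure, defined
on all subsets, that is invariant under right translations. -/
def IsAmenableGroup (G : Type u) [Group G] : Prop :=
  ∃ μ : Set G → ℝ, (∀ A, 0 ≤ μ A) ∧ μ Set.univ = 1 ∧
    (∀ A B, Disjoint A B → μ (A ∪ B) = μ A + μ B) ∧
    ∀ (A : Set G) (z : G), μ ((fun a => a * z) '' A) = μ A

/-- A decreasing sequence of normal subgroups with trivial intersection and amenable quotients. -/
structure ResiduallyAmenableSequence (G : Type u) [Group G] where
  /-- The subgroups. -/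
  subgroup : ℕ → Subgroup G
  normal : ∀ n, (subgroup n).Normal
  succ_le : ∀ n, subgroup (n + 1) ≤ subgroup n
  iInf_eq_bot : ⨅ n, subgroup n = ⊥
  amenable : ∀ n, IsAmenableGroup (G ⧸ subgroup n)

attribute [instance] ResiduallyAmenableSequence.normal

/-- Residual amenability. -/
def IsResiduallyAmenable (G : Type u) [Group G] : Prop :=
  Nonempty (ResiduallyAmenableSequence G)

/-- A proper length function: `l 1 = 0`, `l (g * h) ≤ l g + l h`, `l g⁻¹ = l g`, `l g = 0` only for
`g = 1` (these are the fields of `GroupNorm`), and all balls are finite. -/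
structure ProperLength (G : Type u) [Group G] extends GroupNorm G where
  finite_ball : ∀ R : ℝ, {g : G | toFun g ≤ R}.Finite

namespace ProperLength

variable {G : Type u} [Group G] (l : ProperLength G) (N : Subgroup G)

/-- The quotient length `[g] ↦ inf {l (g * h) | h ∈ N}`, that is, the infimum of `l` over the
coset. -/
noncomputable def quotientLength (q : G ⧸ N) : ℝ :=
  sInf {t : ℝ | ∃ g : G, (g : G ⧸ N) = q ∧ l.toGroupNorm g = t}

theorem quotientLength_le (g : G) : l.quotientLength N g ≤ l.toGroupNorm g :=
  csInf_le ⟨0, by rintro _ ⟨x, -, rfl⟩; exact apply_nonneg _ _⟩ ⟨g, rfl, rfl⟩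

/-- The infimum is attained. -/
theorem exists_quotientLength_eq (q : G ⧸ N) :
    ∃ g : G, (g : G ⧸ N) = q ∧ l.toGroupNorm g = l.quotientLength N q := by
  obtain ⟨g₀, rfl⟩ := QuotientGroup.mk_surjective q
  have hfin : {g : G | (g : G ⧸ N) = g₀ ∧ l.toGroupNorm g ≤ l.toGroupNorm g₀}.Finite :=
    (l.finite_ball (l.toGroupNorm g₀)).subset fun g hg => hg.2
  obtain ⟨m, hm, hmin⟩ :=
    Set.exists_min_image _ l.toGroupNorm hfin ⟨g₀, rfl, le_rfl⟩
  refine ⟨m, hm.1, le_antisymm ?_ ?_⟩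
  · refine le_csInf ⟨_, g₀, rfl, rfl⟩ ?_
    rintro _ ⟨x, hx, rfl⟩
    rcases le_total (l.toGroupNorm x) (l.toGroupNorm g₀) with h | h
    · exact hmin x ⟨hx, h⟩
    · exact hm.2.trans h
  · rw [← hm.1]
    exact l.quotientLength_le N m

variable [N.Normal]

/-- The left-invariant metric `d([g],[h]) = inf {l (g⁻¹ * h * k) | k ∈ N}` on the quotient group. -/
noncomputable abbrev quotientMetric : MetricSpace (G ⧸ N) where
  dist a b := l.quotientLength N (a⁻¹ * b)
  dist_self a := by
    obtain ⟨g, -, hg⟩ := l.exists_quotientLength_eq N (a⁻¹ * a)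
    refine le_antisymm ?_ (hg ▸ apply_nonneg l.toGroupNorm g)
    have h := l.quotientLength_le N 1
    rw [map_one_eq_zero] at h
    simpa using h
  dist_comm a b := by
    have key : ∀ q : G ⧸ N, l.quotientLength N q⁻¹ ≤ l.quotientLength N q := by
      intro q
      obtain ⟨g, rfl, hg⟩ := l.exists_quotientLength_eq N q
      rw [← hg, ← map_inv_eq_map l.toGroupNorm g]
      exact l.quotientLength_le N g⁻¹
    have h₁ := key (a⁻¹ * b)
    have h₂ := key (b⁻¹ * a)
    simp only [mul_inv_rev, inv_inv] at h₁ h₂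
    exact le_antisymm h₂ h₁
  dist_triangle a b c := by
    obtain ⟨g, hg, hg'⟩ := l.exists_quotientLength_eq N (a⁻¹ * b)
    obtain ⟨h, hh, hh'⟩ := l.exists_quotientLength_eq N (b⁻¹ * c)
    have e : ((g * h : G) : G ⧸ N) = a⁻¹ * c := by
      rw [QuotientGroup.mk_mul, hg, hh]; group
    rw [← hg', ← hh', ← e]
    exact (l.quotientLength_le N (g * h)).trans (map_mul_le_add _ g h)
  eq_of_dist_eq_zero {a b} hab := by
    obtain ⟨g, hg, hg'⟩ := l.exists_quotientLength_eq N (a⁻¹ * b)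
    rw [hab, map_eq_zero_iff_eq_one] at hg'
    rw [hg', QuotientGroup.mk_one] at hg
    exact (inv_mul_eq_one.1 hg.symm)

end ProperLength

/-- The data defining a box family of `G`: a proper length function on `G` and a decreasing
sequence of normal subgroups with trivial intersection and amenable quotients. -/
structure BoxFamily (G : Type u) [Group G] extends ResiduallyAmenableSequence G where
  /-- The proper length function. -/
  length : ProperLength G

namespace BoxFamily

variable {G : Type u} [Group G]

/-- The `n`-th member `G / G_n` of the box family. -/
def Space (X : BoxFamily G) (n : ℕ) : Type u := G ⧸ X.subgroup n

noncomputable instance (X : BoxFamily G) (n : ℕ) : MetricSpace (X.Space n) :=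
  X.length.quotientMetric (X.subgroup n)

end BoxFamily

/-- The (disjoint, indexed) family of metric spaces `X i` admits a fibred cofinitely-coarse
embedding into the metric space `Y`: `F` is the field of metric spaces, `s` the section, `K` the
finite subfamily depending on `r`, and `t i C x : F i x ≃ᵢ Y` is the restriction of the
trivialization over `C` to the fibre at `x`. The trivializations are only constrained
for `i ∉ K`, `C` of diameter less than `r` and `x ∈ C`; elsewhere `t i C x` is an arbitrary isometry
(there is one because each fibre is isometric to `Y`). -/
def AdmitsFibredCofinitelyCoarseEmbedding {ι : Type w} (X : ι → Type u) [∀ i, MetricSpace (X i)]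
    (Y : Type v) [MetricSpace Y] : Prop :=
  ∃ (F : ∀ i, X i → Type v) (_ : ∀ i x, MetricSpace (F i x)) (s : ∀ i x, F i x) (ρ₁ ρ₂ : ℝ → ℝ),
    (∀ i x, Nonempty (F i x ≃ᵢ Y)) ∧
    MonotoneOn ρ₁ (Set.Ici 0) ∧ Filter.Tendsto ρ₁ Filter.atTop Filter.atTop ∧
    MonotoneOn ρ₂ (Set.Ici 0) ∧ Filter.Tendsto ρ₂ Filter.atTop Filter.atTop ∧
    ∀ r : ℝ, 0 < r → ∃ (K : Finset ι) (t : ∀ i, Set (X i) → ∀ x : X i, F i x ≃ᵢ Y), ∀ i ∉ K,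
      (∀ C : Set (X i), Metric.ediam C < ENNReal.ofReal r → ∀ x ∈ C, ∀ x' ∈ C,
        ρ₁ (dist x x') ≤ dist (t i C x (s i x)) (t i C x' (s i x')) ∧
        dist (t i C x (s i x)) (t i C x' (s i x')) ≤ ρ₂ (dist x x')) ∧
      (∀ C₁ C₂ : Set (X i), Metric.ediam C₁ < ENNReal.ofReal r →
        Metric.ediam C₂ < ENNReal.ofReal r → (C₁ ∩ C₂).Nonempty →
        ∃ T : Y → Y, Isometry T ∧
          ∀ x ∈ C₁ ∩ C₂, ∀ y : Y, t i C₁ x ((t i C₂ x).symm y) = T y)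

/-- The box family admits a fibred cofinitely-coarse embedding into some uniformly convex (real)
Banach space. -/
def BoxFamily.EmbedsInUniformlyConvex {G : Type u} [Group G] (X : BoxFamily G) : Prop :=
  ∃ (B : Type u) (_ : NormedAddCommGroup B) (_ : NormedSpace ℝ B),
    CompleteSpace B ∧ UniformConvexSpace B ∧ AdmitsFibredCofinitelyCoarseEmbedding X.Space B

/-- An affine isometric action (a homomorphism to the group of affine isometries) is proper if for
each point only finitely many group elements move it into a given bounded set. -/
def IsProperAffineAction {G : Type u} [Group G] {B : Type v} [NormedAddCommGroup B]
    [NormedSpace ℝ B] (α : G →* (B ≃ᵃⁱ[ℝ] B)) : Prop :=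
  ∀ (ξ : B) (A : Set B), Bornology.IsBounded A → {g : G | α g ξ ∈ A}.Finite

/-- `G` admits a proper isometric affine action on some uniformly convex (real) Banach space. -/
def ActsProperlyOnUniformlyConvex (G : Type u) [Group G] : Prop :=
  ∃ (B : Type u) (_ : NormedAddCommGroup B) (_ : NormedSpace ℝ B),
    CompleteSpace B ∧ UniformConvexSpace B ∧ ∃ α : G →* (B ≃ᵃⁱ[ℝ] B), IsProperAffineAction α

/-! A proper action `α` gives a fibred embedding of any box family. On a set `C` of diameter less
than `r`, with `n` large, choose a base point and lift `C` to `G` by minimal representatives. Once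
`G_n` meets the ball of radius `3r` only in `1`, these lifts are compatible with differences. All
fibres are `B`, the section is `0`, and the trivialization at `x` is `α` of the lift of `x`. Two
lifts of the same points differ by a left translation, so the transition maps do not depend on the
point (`ActsProperlyOnUniformlyConvex.embeds`).

Conversely, a fibred embedding yields a parallel transport `V x y` between nearby fibres, with `V x
y ∘ V y z = V x z` (`exists_transport`). The metric is left invariant, so `x ↦ x * g` moves all
points of `G / G_n` equally far, and `V x (x * g)` is a cocycle over right translation, valid for
large `n` once `g` is fixed. Amenability supplies invariant finitely additive probabilities on the
quotients. An ultralimit of these on the disjoint union ignores every initial segment, so the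
identities hold up to null sets. The cocycle then acts isometrically on the `L²`-space of this
measure; by Mazur–Ulam the action on the completion is affine, and the lower control function makes
it proper (`exists_affineIsometricAction_of_cocycle`).

Uniform convexity survives because it is equivalent to an inequality linear in squared norms
(`QuadraticallyUniformlyConvex`), which can be integrated pointwise and passes to completions. -/

/-! ### Means on bounded real functions. -/

/-- A real function is bounded in absolute value. -/
def BoundedReal {Z : Type u} (f : Z → ℝ) : Prop := ∃ C, ∀ z, |f z| ≤ C

namespace BoundedReal

variable {Z : Type u} {f g : Z → ℝ}

theorem add (hf : BoundedReal f) (hg : BoundedReal g) : BoundedReal fun z => f z + g z := by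
  obtain ⟨C, hC⟩ := hf
  obtain ⟨D, hD⟩ := hg
  exact ⟨C + D, fun z => (abs_add_le _ _).trans (add_le_add (hC z) (hD z))⟩

theorem const_mul (c : ℝ) (hf : BoundedReal f) : BoundedReal fun z => c * f z := by
  obtain ⟨C, hC⟩ := hf
  refine ⟨|c| * C, fun z => ?_⟩
  rw [abs_mul]
  exact mul_le_mul_of_nonneg_left (hC z) (abs_nonneg c)

theorem const (c : ℝ) : BoundedReal fun _ : Z => c := ⟨|c|, fun _ => le_rfl⟩

theorem sub (hf : BoundedReal f) (hg : BoundedReal g) : BoundedReal fun z => f z - g z := by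
  simpa [sub_eq_add_neg] using hf.add (hg.const_mul (-1))

theorem of_finite_range (hf : (Set.range f).Finite) : BoundedReal f := by
  obtain ⟨C, hC⟩ := (hf.image abs).bddAbove
  exact ⟨C, fun z => hC ⟨f z, ⟨z, rfl⟩, rfl⟩⟩

theorem indicator (A : Set Z) : BoundedReal (A.indicator fun _ => (1 : ℝ)) := by
  refine ⟨1, fun z => ?_⟩
  by_cases h : z ∈ A <;> simp [h]

end BoundedReal

/-- A mean on the bounded real functions on a set; the values on unbounded functions are not
constrained. -/
structure MeanFunctional (Z : Type u) where
  /-- The underlying functional. -/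
  toFun : (Z → ℝ) → ℝ
  add' : ∀ {f g : Z → ℝ}, BoundedReal f → BoundedReal g →
    toFun (fun z => f z + g z) = toFun f + toFun g
  const_mul' : ∀ (c : ℝ) {f : Z → ℝ}, BoundedReal f → toFun (fun z => c * f z) = c * toFun f
  mono' : ∀ {f g : Z → ℝ}, BoundedReal f → BoundedReal g → (∀ z, f z ≤ g z) → toFun f ≤ toFun g
  one' : toFun (fun _ => 1) = 1

namespace MeanFunctional

variable {Z : Type u} (M : MeanFunctional Z)

theorem const (c : ℝ) : M.toFun (fun _ => c) = c := by
  simpa [M.one'] using M.const_mul' c (BoundedReal.const (Z := Z) 1)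

theorem nonneg {f : Z → ℝ} (hf : BoundedReal f) (h : ∀ z, 0 ≤ f z) : 0 ≤ M.toFun f := by
  simpa [M.const] using M.mono' (BoundedReal.const 0) hf h

/-- The inequality holds outside a set of measure zero. -/
theorem mono_of_null {f g : Z → ℝ} (hf : BoundedReal f) (hg : BoundedReal g) {A : Set Z}
    (hA : M.toFun (A.indicator fun _ => 1) = 0) (h : ∀ z ∉ A, f z ≤ g z) :
    M.toFun f ≤ M.toFun g := by
  obtain ⟨C, hC⟩ := hf.sub hg
  have hb := (BoundedReal.indicator A).const_mul C
  -- `C` bounds `|f - g|`, so `f ≤ g + C * 1_A` everywhere, and the extra term has mean zero.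
  have := M.mono' hf (hg.add hb) fun z => by
    by_cases hz : z ∈ A
    · have := (le_abs_self _).trans (hC z)
      simp only [hz, Set.indicator_of_mem]
      linarith
    · simpa [hz] using h z hz
  rwa [M.add' hg hb, M.const_mul' C (BoundedReal.indicator A), hA, mul_zero, add_zero] at this

theorem congr_of_null {f g : Z → ℝ} (hf : BoundedReal f) (hg : BoundedReal g) {A : Set Z}
    (hA : M.toFun (A.indicator fun _ => 1) = 0) (h : ∀ z ∉ A, f z = g z) :
    M.toFun f = M.toFun g :=
  le_antisymm (M.mono_of_null hf hg hA fun z hz => (h z hz).le)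
    (M.mono_of_null hg hf hA fun z hz => (h z hz).ge)

end MeanFunctional

/-! ### Integration against finitely additive probabilities. -/

/-- A finitely additive probability measure on all subsets. -/
structure FinAddProb (Z : Type u) where
  /-- The underlying set function. -/
  toFun : Set Z → ℝ
  nonneg' : ∀ A, 0 ≤ toFun A
  univ' : toFun Set.univ = 1
  union' : ∀ A B, Disjoint A B → toFun (A ∪ B) = toFun A + toFun B

namespace FinAddProb

open MeasureTheory

variable {Z : Type u} (μ : FinAddProb Z)

theorem empty : μ.toFun ∅ = 0 := by
  have := μ.union' ∅ ∅ (by simp)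
  simp only [Set.union_self] at this
  linarith

theorem mem_Icc (A : Set Z) : μ.toFun A ∈ Set.Icc (0 : ℝ) 1 := by
  refine ⟨μ.nonneg' A, ?_⟩
  have h := μ.union' A Aᶜ disjoint_compl_right
  rw [Set.union_compl_self, μ.univ'] at h
  linarith [μ.nonneg' Aᶜ]

/-- The measure as a function with values in linear functionals. -/
noncomputable def toCLM (A : Set Z) : ℝ →L[ℝ] ℝ := μ.toFun A • ContinuousLinearMap.id ℝ ℝ

/-- The integral of a function with finitely many values, and `0` for other functions. -/
noncomputable def simpleIntegral (f : Z → ℝ) : ℝ := by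
  classical
  exact if h : (Set.range f).Finite then ∑ x ∈ h.toFinset, μ.toFun (f ⁻¹' {x}) * x else 0

/-- The reference measure `0` makes all finiteness and integrability conditions automatic, so the
linearity of `setToSimpleFunc` applies to a measure that is only finitely additive. -/
theorem finMeasAdditive [MeasurableSpace Z] : FinMeasAdditive (0 : Measure Z) μ.toCLM := by
  intro s t _ _ _ _ hst
  simp [toCLM, μ.union' s t hst, add_smul]

theorem simpleIntegral_eq [MeasurableSpace Z] (f : SimpleFunc Z ℝ) :
    μ.simpleIntegral f = f.setToSimpleFunc μ.toCLM := by
  have h : (Set.range f).Finite := f.finite_range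
  rw [simpleIntegral, dif_pos h, SimpleFunc.setToSimpleFunc]
  refine Finset.sum_congr ?_ fun x _ => by simp [toCLM]
  ext x
  simp

/-- Every function with finitely many values is simple for the discrete σ-algebra. -/
theorem exists_simpleFunc {f : Z → ℝ} (hf : (Set.range f).Finite) :
    ∃ g : @SimpleFunc Z ⊤ ℝ, ⇑g = f :=
  letI : MeasurableSpace Z := ⊤
  ⟨⟨f, fun _ => trivial, hf⟩, rfl⟩

theorem simpleIntegral_add {f g : Z → ℝ} (hf : (Set.range f).Finite) (hg : (Set.range g).Finite) :
    μ.simpleIntegral (fun z => f z + g z) = μ.simpleIntegral f + μ.simpleIntegral g := by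
  let _ : MeasurableSpace Z := ⊤
  obtain ⟨f, rfl⟩ := exists_simpleFunc hf
  obtain ⟨g, rfl⟩ := exists_simpleFunc hg
  rw [μ.simpleIntegral_eq f, μ.simpleIntegral_eq g,
    ← SimpleFunc.setToSimpleFunc_add (μ := (0 : Measure Z)) _ μ.finMeasAdditive
      (integrable_zero_measure) (integrable_zero_measure), ← simpleIntegral_eq]
  rfl

theorem simpleIntegral_const_mul (c : ℝ) {f : Z → ℝ} (hf : (Set.range f).Finite) :
    μ.simpleIntegral (fun z => c * f z) = c * μ.simpleIntegral f := by
  let _ : MeasurableSpace Z := ⊤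
  obtain ⟨f, rfl⟩ := exists_simpleFunc hf
  rw [μ.simpleIntegral_eq f, ← smul_eq_mul c,
    ← SimpleFunc.setToSimpleFunc_smul_real (μ := (0 : Measure Z)) _ μ.finMeasAdditive c
      (integrable_zero_measure), ← simpleIntegral_eq]
  rfl

theorem simpleIntegral_nonneg {f : Z → ℝ} (hf : (Set.range f).Finite) (h : ∀ z, 0 ≤ f z) :
    0 ≤ μ.simpleIntegral f := by
  rw [simpleIntegral, dif_pos hf]
  refine Finset.sum_nonneg fun x hx => mul_nonneg (μ.nonneg' _) ?_
  obtain ⟨z, rfl⟩ := (Set.Finite.mem_toFinset hf).1 hx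
  exact h z

theorem simpleIntegral_mono {f g : Z → ℝ} (hf : (Set.range f).Finite) (hg : (Set.range g).Finite)
    (h : ∀ z, f z ≤ g z) : μ.simpleIntegral f ≤ μ.simpleIntegral g := by
  have hf' : (Set.range fun z => -1 * f z).Finite := by
    rw [show (fun z => -1 * f z) = (fun t => -1 * t) ∘ f from rfl, Set.range_comp]
    exact hf.image _
  have h1 : (Set.range fun z => g z + -1 * f z).Finite :=
    (Set.Finite.image2 (· + ·) hg hf').subset (by
      rintro _ ⟨z, rfl⟩; exact ⟨_, ⟨z, rfl⟩, _, ⟨z, rfl⟩, rfl⟩)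
  have h2 := μ.simpleIntegral_nonneg h1 fun z => by linarith [h z]
  rw [μ.simpleIntegral_add hg hf', μ.simpleIntegral_const_mul _ hf] at h2
  linarith

theorem simpleIntegral_indicator (A : Set Z) :
    μ.simpleIntegral (A.indicator fun _ => 1) = μ.toFun A := by
  let _ : MeasurableSpace Z := ⊤
  have hA : MeasurableSet A := trivial
  have h := SimpleFunc.setToSimpleFunc_indicator μ.toCLM (by simp [toCLM, μ.empty]) hA (1 : ℝ)
  rw [← simpleIntegral_eq, SimpleFunc.coe_piecewise] at h
  rw [show (A.indicator fun _ => (1 : ℝ)) = A.indicator 1 from rfl]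
  simpa [toCLM, Set.piecewise_eq_indicator] using h

theorem simpleIntegral_const (c : ℝ) : μ.simpleIntegral (fun _ => c) = c := by
  have h1 : (Set.range fun _ : Z => (1 : ℝ)).Finite :=
    (Set.finite_singleton 1).subset (by rintro _ ⟨z, rfl⟩; rfl)
  have := μ.simpleIntegral_const_mul c h1
  have h := μ.simpleIntegral_indicator Set.univ
  rw [Set.indicator_univ, μ.univ'] at h
  simpa [h] using this

theorem simpleIntegral_comp (e : Z ≃ Z) (he : ∀ A, μ.toFun (e ⁻¹' A) = μ.toFun A) (f : Z → ℝ) :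
    μ.simpleIntegral (fun z => f (e z)) = μ.simpleIntegral f := by
  have hr : Set.range (fun z => f (e z)) = Set.range f := e.surjective.range_comp f
  unfold simpleIntegral
  by_cases hf : (Set.range f).Finite
  · rw [dif_pos hf, dif_pos (hr ▸ hf)]
    refine Finset.sum_congr (by ext; simp [← hr]) fun x _ => ?_
    rw [← he (f ⁻¹' {x})]
    rfl
  · rw [dif_neg hf, dif_neg (hr ▸ hf)]

/-- The upper integral with respect to a finitely additive probability measure. -/
noncomputable def integral (f : Z → ℝ) : ℝ :=
  sInf {t | ∃ g : Z → ℝ, (Set.range g).Finite ∧ (∀ z, f z ≤ g z) ∧ μ.simpleIntegral g = t}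

theorem integral_le {f g : Z → ℝ} (hf : BoundedReal f) (hg : (Set.range g).Finite)
    (h : ∀ z, f z ≤ g z) : μ.integral f ≤ μ.simpleIntegral g := by
  refine csInf_le ?_ ⟨g, hg, h, rfl⟩
  obtain ⟨C, hC⟩ := hf
  refine ⟨-C, ?_⟩
  rintro _ ⟨k, hk, hfk, rfl⟩
  rw [← μ.simpleIntegral_const (-C)]
  exact μ.simpleIntegral_mono (Set.finite_range_const) hk
    fun z => (neg_le_of_abs_le (hC z)).trans (hfk z)

theorem le_integral {f g : Z → ℝ} (hf : BoundedReal f) (hg : (Set.range g).Finite)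
    (h : ∀ z, g z ≤ f z) : μ.simpleIntegral g ≤ μ.integral f := by
  obtain ⟨C, hC⟩ := hf
  refine le_csInf ⟨_, fun _ => C, Set.finite_range_const, fun z => (le_abs_self _).trans (hC z), rfl⟩
    ?_
  rintro _ ⟨k, hk, hfk, rfl⟩
  exact μ.simpleIntegral_mono hg hk fun z => (h z).trans (hfk z)

theorem integral_eq_simpleIntegral {f : Z → ℝ} (hf : (Set.range f).Finite) :
    μ.integral f = μ.simpleIntegral f :=
  le_antisymm (μ.integral_le (.of_finite_range hf) hf fun _ => le_rfl)
    (μ.le_integral (.of_finite_range hf) hf fun _ => le_rfl)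

theorem integral_mono {f g : Z → ℝ} (hf : BoundedReal f) (hg : BoundedReal g)
    (h : ∀ z, f z ≤ g z) : μ.integral f ≤ μ.integral g := by
  obtain ⟨C, hC⟩ := hg
  refine le_csInf ⟨_, fun _ => C, Set.finite_range_const, fun z => (le_abs_self _).trans (hC z), rfl⟩
    ?_
  rintro _ ⟨k, hk, hfk, rfl⟩
  exact μ.integral_le hf hk fun z => (h z).trans (hfk z)

/-- Uniform approximation of a bounded function by functions with finitely many values. -/
theorem exists_finite_range_approx {f : Z → ℝ} (hf : BoundedReal f) {ε : ℝ} (hε : 0 < ε) :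
    ∃ g : Z → ℝ, (Set.range g).Finite ∧ (∀ z, g z ≤ f z) ∧ ∀ z, f z ≤ g z + ε := by
  obtain ⟨C, hC⟩ := hf
  refine ⟨fun z => ε * (⌊f z / ε⌋ : ℤ), ?_, fun z => ?_, fun z => ?_⟩
  · refine ((Set.finite_Icc ⌊-C / ε⌋ ⌊C / ε⌋).image fun n : ℤ => ε * (n : ℝ)).subset ?_
    rintro _ ⟨z, rfl⟩
    refine ⟨_, ⟨Int.floor_mono ?_, Int.floor_mono ?_⟩, rfl⟩
    · exact div_le_div_of_nonneg_right (neg_le_of_abs_le (hC z)) hε.le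
    · exact div_le_div_of_nonneg_right ((le_abs_self _).trans (hC z)) hε.le
  · have := Int.floor_le (f z / ε)
    rw [le_div_iff₀ hε] at this
    linarith
  · have := Int.lt_floor_add_one (f z / ε)
    rw [div_lt_iff₀ hε] at this
    linarith

theorem exists_simple_bounds {f : Z → ℝ} (hf : BoundedReal f) {ε : ℝ} (hε : 0 < ε) :
    ∃ g : Z → ℝ, (Set.range g).Finite ∧ (∀ z, g z ≤ f z) ∧ (∀ z, f z ≤ g z + ε) ∧
      μ.integral f ≤ μ.simpleIntegral g + ε ∧ μ.simpleIntegral g ≤ μ.integral f := by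
  obtain ⟨g, hg, h1, h2⟩ := exists_finite_range_approx hf hε
  refine ⟨g, hg, h1, h2, ?_, μ.le_integral hf hg h1⟩
  have hr : (Set.range fun z => g z + ε).Finite := by
    rw [show (fun z => g z + ε) = (fun t => t + ε) ∘ g from rfl, Set.range_comp]
    exact hg.image _
  refine (μ.integral_le hf hr h2).trans ?_
  rw [μ.simpleIntegral_add hg Set.finite_range_const, μ.simpleIntegral_const]

/-- With `a`, `b` finite-valued and within `ε / 2` below `f`, `g`, both sides lie between the simple
integral of `a + b` and that value plus `ε`. -/
theorem integral_add {f g : Z → ℝ} (hf : BoundedReal f) (hg : BoundedReal g) :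
    μ.integral (fun z => f z + g z) = μ.integral f + μ.integral g := by
  refine eq_of_forall_dist_le fun ε hε => ?_
  rw [Real.dist_eq]
  obtain ⟨a, ha, a1, a2, a3, a4⟩ := μ.exists_simple_bounds hf (half_pos hε)
  obtain ⟨b, hb, b1, b2, b3, b4⟩ := μ.exists_simple_bounds hg (half_pos hε)
  have hab : (Set.range fun z => a z + b z).Finite :=
    (Set.Finite.image2 (· + ·) ha hb).subset (by
      rintro _ ⟨z, rfl⟩; exact ⟨_, ⟨z, rfl⟩, _, ⟨z, rfl⟩, rfl⟩)
  have habε : (Set.range fun z => a z + b z + ε).Finite := by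
    rw [show (fun z => a z + b z + ε) = (fun t => t + ε) ∘ fun z => a z + b z from rfl,
      Set.range_comp]
    exact hab.image _
  have h1 := μ.le_integral (hf.add hg) hab fun z => add_le_add (a1 z) (b1 z)
  have h2 := μ.integral_le (hf.add hg) habε fun z => by linarith [a2 z, b2 z]
  rw [μ.simpleIntegral_add hab Set.finite_range_const, μ.simpleIntegral_const] at h2
  rw [μ.simpleIntegral_add ha hb] at h1 h2
  rw [abs_le]
  constructor <;> linarith

theorem integral_neg {f : Z → ℝ} (hf : BoundedReal f) :
    μ.integral (fun z => -1 * f z) = -1 * μ.integral f := by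
  have h := μ.integral_add hf (hf.const_mul (-1))
  have h0 : (fun z => f z + -1 * f z) = fun _ => 0 := by ext; ring
  rw [h0, μ.integral_eq_simpleIntegral Set.finite_range_const, μ.simpleIntegral_const] at h
  linarith

theorem integral_const_mul (c : ℝ) {f : Z → ℝ} (hf : BoundedReal f) :
    μ.integral (fun z => c * f z) = c * μ.integral f := by
  have key : ∀ c : ℝ, 0 ≤ c → μ.integral (fun z => c * f z) = c * μ.integral f := by
    intro c hc
    refine eq_of_forall_dist_le fun ε hε => ?_
    rw [Real.dist_eq]
    -- Dividing by `c + 1` rather than `c` covers `c = 0`.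
    obtain ⟨a, ha, a1, a2, a3, a4⟩ := μ.exists_simple_bounds hf (div_pos hε (by linarith : 0 < c + 1))
    set η := ε / (c + 1)
    have hη : c * η ≤ ε := by
      have : (c + 1) * η = ε := mul_div_cancel₀ _ (by linarith)
      have : 0 < η := div_pos hε (by linarith)
      nlinarith
    have hca : (Set.range fun z => c * a z).Finite := by
      rw [show (fun z => c * a z) = (fun t => c * t) ∘ a from rfl, Set.range_comp]
      exact ha.image _
    have hcaε : (Set.range fun z => c * a z + c * η).Finite := by
      rw [show (fun z => c * a z + c * η) = (fun t => c * t + c * η) ∘ a from rfl, Set.range_comp]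
      exact ha.image _
    have h1 := μ.le_integral (hf.const_mul c) hca fun z => mul_le_mul_of_nonneg_left (a1 z) hc
    have h2 := μ.integral_le (hf.const_mul c) hcaε fun z => by
      rw [← mul_add]; exact mul_le_mul_of_nonneg_left (a2 z) hc
    rw [μ.simpleIntegral_add hca Set.finite_range_const, μ.simpleIntegral_const] at h2
    rw [μ.simpleIntegral_const_mul c ha] at h1 h2
    have h3 := mul_le_mul_of_nonneg_left a3 hc
    have h4 := mul_le_mul_of_nonneg_left a4 hc
    rw [abs_le]
    constructor <;> linarith
  rcases le_total 0 c with hc | hc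
  · exact key c hc
  · have h1 := key (-c) (by linarith)
    have h2 := μ.integral_neg (hf.const_mul c)
    have h3 : (fun z => -1 * (c * f z)) = fun z => -c * f z := by ext; ring
    rw [h3, h1] at h2
    linarith

/-- The mean given by a finitely additive probability measure. -/
noncomputable def mean : MeanFunctional Z where
  toFun := μ.integral
  add' := μ.integral_add
  const_mul' := μ.integral_const_mul
  mono' := μ.integral_mono
  one' := by rw [μ.integral_eq_simpleIntegral Set.finite_range_const, μ.simpleIntegral_const]

theorem mean_indicator (A : Set Z) : μ.mean.toFun (A.indicator fun _ => 1) = μ.toFun A := by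
  refine (μ.integral_eq_simpleIntegral ?_).trans (μ.simpleIntegral_indicator A)
  refine ((Set.finite_singleton (1 : ℝ)).insert 0).subset ?_
  rintro _ ⟨z, rfl⟩
  by_cases h : z ∈ A <;> simp [h]

/-- Composition with `e` matches the finite-valued majorants of the two functions and preserves
their simple integrals, so the infima agree, even for unbounded `f`. -/
theorem mean_comp (e : Z ≃ Z) (he : ∀ A, μ.toFun (e ⁻¹' A) = μ.toFun A) (f : Z → ℝ) :
    μ.mean.toFun (fun z => f (e z)) = μ.mean.toFun f := by
  change sInf _ = sInf _
  congr 1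
  ext t
  constructor
  · rintro ⟨g, hg, hfg, rfl⟩
    refine ⟨fun z => g (e.symm z), hg.subset ?_, fun z => by simpa using hfg (e.symm z), ?_⟩
    · rintro _ ⟨z, rfl⟩; exact ⟨_, rfl⟩
    · simpa using (μ.simpleIntegral_comp e he fun z => g (e.symm z)).symm
  · rintro ⟨g, hg, hfg, rfl⟩
    refine ⟨fun z => g (e z), hg.subset ?_, fun z => hfg (e z), μ.simpleIntegral_comp e he g⟩
    rintro _ ⟨z, rfl⟩; exact ⟨_, rfl⟩

end FinAddProb

/-! ### The `L²`-space of a mean. -/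

/-- The submodule of bounded functions. -/
def boundedFunctions (Z : Type u) (B : Type v) [NormedAddCommGroup B] [NormedSpace ℝ B] :
    Submodule ℝ (Z → B) where
  carrier := {ξ | ∃ C, ∀ z, ‖ξ z‖ ≤ C}
  add_mem' := by
    rintro ξ η ⟨C, hC⟩ ⟨D, hD⟩
    exact ⟨C + D, fun z => norm_add_le_of_le (hC z) (hD z)⟩
  zero_mem' := ⟨0, fun z => by simp⟩
  smul_mem' := by
    rintro c ξ ⟨C, hC⟩
    refine ⟨‖c‖ * C, fun z => ?_⟩
    rw [Pi.smul_apply, norm_smul]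
    exact mul_le_mul_of_nonneg_left (hC z) (norm_nonneg c)

/-- Bounded functions, to be endowed with the `L²`-seminorm of a mean. -/
def MeanL2 {Z : Type u} (_ : MeanFunctional Z) (B : Type v) [NormedAddCommGroup B]
    [NormedSpace ℝ B] : Type max u v :=
  boundedFunctions Z B

namespace MeanL2

variable {Z : Type u} {M : MeanFunctional Z} {B : Type v} [NormedAddCommGroup B] [NormedSpace ℝ B]

instance : AddCommGroup (MeanL2 M B) := inferInstanceAs (AddCommGroup (boundedFunctions Z B))

instance : Module ℝ (MeanL2 M B) := inferInstanceAs (Module ℝ (boundedFunctions Z B))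

instance : CoeFun (MeanL2 M B) fun _ => Z → B := ⟨fun ξ => ξ.1⟩

@[simp] theorem add_apply (ξ η : MeanL2 M B) (z : Z) : (ξ + η) z = ξ z + η z := rfl

@[simp] theorem sub_apply (ξ η : MeanL2 M B) (z : Z) : (ξ - η) z = ξ z - η z := rfl

@[simp] theorem neg_apply (ξ : MeanL2 M B) (z : Z) : (-ξ) z = -ξ z := rfl

@[simp] theorem zero_apply (z : Z) : (0 : MeanL2 M B) z = 0 := rfl

@[simp] theorem smul_apply (c : ℝ) (ξ : MeanL2 M B) (z : Z) : (c • ξ) z = c • ξ z := rfl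

theorem boundedReal_norm_sq (ξ : MeanL2 M B) : BoundedReal fun z => ‖ξ z‖ ^ 2 := by
  obtain ⟨C, hC⟩ := ξ.2
  refine ⟨C ^ 2, fun z => ?_⟩
  rw [abs_of_nonneg (sq_nonneg _)]
  exact pow_le_pow_left₀ (norm_nonneg _) (hC z) 2

variable (M B) in
/-- The `L²`-seminorm of a mean. -/
noncomputable def seminorm : AddGroupSeminorm (MeanL2 M B) where
  toFun ξ := √(M.toFun fun z => ‖ξ z‖ ^ 2)
  map_zero' := by simp [M.const]
  neg' ξ := by simp
  add_le' ξ η := by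
    have hξ := M.nonneg ξ.boundedReal_norm_sq fun z => sq_nonneg _
    have hη := M.nonneg η.boundedReal_norm_sq fun z => sq_nonneg _
    refine le_of_forall_pos_le_add fun ε hε => ?_
    -- The triangle inequality comes from `(p + q)² ≤ (1 + b/a) p² + (1 + a/b) q²`, with weights
    -- close to the two seminorms; adding `ε / 2` keeps them positive.
    set a := √(M.toFun fun z => ‖ξ z‖ ^ 2) + ε / 2 with ha
    set b := √(M.toFun fun z => ‖η z‖ ^ 2) + ε / 2 with hb
    have ha0 : 0 < a := by positivity
    have hb0 : 0 < b := by positivity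
    have hξa : (M.toFun fun z => ‖ξ z‖ ^ 2) ≤ a ^ 2 := by
      rw [← Real.sqrt_le_left ha0.le]; linarith
    have hηb : (M.toFun fun z => ‖η z‖ ^ 2) ≤ b ^ 2 := by
      rw [← Real.sqrt_le_left hb0.le]; linarith
    suffices h : √(M.toFun fun z => ‖(ξ + η) z‖ ^ 2) ≤ a + b by linarith
    rw [Real.sqrt_le_left (by positivity)]
    have hbξ := ξ.boundedReal_norm_sq.const_mul (1 + b / a)
    have hbη := η.boundedReal_norm_sq.const_mul (1 + a / b)
    have h := M.mono' (ξ + η).boundedReal_norm_sq (hbξ.add hbη) fun z => by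
      have h1 : ‖(ξ + η) z‖ ^ 2 ≤ (‖ξ z‖ + ‖η z‖) ^ 2 :=
        pow_le_pow_left₀ (norm_nonneg _) (norm_add_le _ _) 2
      refine h1.trans ?_
      have h2 : (1 + b / a) * ‖ξ z‖ ^ 2 + (1 + a / b) * ‖η z‖ ^ 2 - (‖ξ z‖ + ‖η z‖) ^ 2
          = (b * ‖ξ z‖ - a * ‖η z‖) ^ 2 / (a * b) := by
        field_simp; ring
      have h3 : 0 ≤ (b * ‖ξ z‖ - a * ‖η z‖) ^ 2 / (a * b) := by positivity
      linarith
    rw [M.add' hbξ hbη, M.const_mul' _ ξ.boundedReal_norm_sq,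
      M.const_mul' _ η.boundedReal_norm_sq] at h
    refine h.trans ?_
    calc _ ≤ (1 + b / a) * a ^ 2 + (1 + a / b) * b ^ 2 := by gcongr
      _ = (a + b) ^ 2 := by field_simp; ring

noncomputable instance : SeminormedAddCommGroup (MeanL2 M B) :=
  (seminorm M B).toSeminormedAddCommGroup

theorem norm_eq (ξ : MeanL2 M B) : ‖ξ‖ = √(M.toFun fun z => ‖ξ z‖ ^ 2) := rfl

theorem norm_sq_eq (ξ : MeanL2 M B) : ‖ξ‖ ^ 2 = M.toFun fun z => ‖ξ z‖ ^ 2 :=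
  Real.sq_sqrt (M.nonneg ξ.boundedReal_norm_sq fun _ => sq_nonneg _)

theorem dist_eq (ξ η : MeanL2 M B) : dist ξ η = √(M.toFun fun z => dist (ξ z) (η z) ^ 2) := by
  rw [dist_eq_norm, norm_eq]
  simp [dist_eq_norm]

noncomputable instance : NormedSpace ℝ (MeanL2 M B) where
  norm_smul_le c ξ := by
    refine le_of_sq_le_sq ?_ (by positivity)
    rw [mul_pow, norm_sq_eq, norm_sq_eq, ← M.const_mul' _ ξ.boundedReal_norm_sq]
    refine le_of_eq ?_
    congr 1
    ext z
    rw [smul_apply, norm_smul, mul_pow]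

end MeanL2

/-! ### Uniform convexity in quadratic form. -/

/-- A quantitative form of uniform convexity that is stable under `L²`-integration. -/
def QuadraticallyUniformlyConvex (E : Type u) [SeminormedAddCommGroup E] : Prop :=
  ∀ ε : ℝ, 0 < ε → ∃ δ : ℝ, 0 < δ ∧ ∀ x y : E,
    δ * (‖x - y‖ ^ 2 - ε * (‖x‖ ^ 2 + ‖y‖ ^ 2)) ≤ (‖x‖ ^ 2 + ‖y‖ ^ 2) / 2 - ‖x + y‖ ^ 2 / 4

namespace QuadraticallyUniformlyConvex

theorem uniformConvexSpace {E : Type u} [SeminormedAddCommGroup E]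
    (h : QuadraticallyUniformlyConvex E) : UniformConvexSpace E := by
  refine ⟨fun ε hε => ?_⟩
  -- For unit vectors at distance at least `ε` this leaves `‖x + y‖² ≤ 4 - 2δε²`. With `m` the
  -- minimum below, this is at most `4 - 4m ≤ (2 - m)²`; the cap at `1` keeps `2 - m` positive.
  obtain ⟨δ, hδ, H⟩ := h (ε ^ 2 / 4) (by positivity)
  refine ⟨min 1 (δ * ε ^ 2 / 2), by positivity, fun x hx y hy hxy => ?_⟩
  have h1 := H x y
  rw [hx, hy] at h1
  have h2 : ε ^ 2 ≤ ‖x - y‖ ^ 2 := pow_le_pow_left₀ hε.le hxy 2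
  have h3 : δ * (ε ^ 2 / 2) ≤ 1 - ‖x + y‖ ^ 2 / 4 := by nlinarith
  set m := min 1 (δ * ε ^ 2 / 2) with hm
  have hm1 : m ≤ 1 := min_le_left _ _
  have hm2 : m ≤ δ * ε ^ 2 / 2 := min_le_right _ _
  have hm0 : 0 < m := by positivity
  refine le_of_sq_le_sq ?_ (by linarith)
  nlinarith

theorem of_uniformConvexSpace (E : Type u) [NormedAddCommGroup E] [NormedSpace ℝ E]
    [UniformConvexSpace E] : QuadraticallyUniformlyConvex E := by
  intro ε hε
  obtain ⟨d₀, hd₀, H⟩ :=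
    exists_forall_closed_ball_dist_add_le_two_sub E (Real.sqrt_pos.2 hε)
  set d := min 1 d₀ with hd
  have hd1 : d ≤ 1 := min_le_left _ _
  have hd2 : d ≤ d₀ := min_le_right _ _
  have hd0 : 0 < d := by positivity
  refine ⟨d ^ 2 / 64, by positivity, ?_⟩
  have key : ∀ x y : E, ‖y‖ ≤ ‖x‖ →
      d ^ 2 / 64 * (‖x - y‖ ^ 2 - ε * (‖x‖ ^ 2 + ‖y‖ ^ 2)) ≤
        (‖x‖ ^ 2 + ‖y‖ ^ 2) / 2 - ‖x + y‖ ^ 2 / 4 := by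
    intro x y hxy
    have hxy0 := norm_nonneg y
    have hadd : ‖x + y‖ ^ 2 ≤ (‖x‖ + ‖y‖) ^ 2 :=
      pow_le_pow_left₀ (norm_nonneg _) (norm_add_le _ _) 2
    have hsub : ‖x - y‖ ^ 2 ≤ (‖x‖ + ‖y‖) ^ 2 :=
      pow_le_pow_left₀ (norm_nonneg _) (norm_sub_le _ _) 2
    have hR : 0 ≤ (‖x‖ ^ 2 + ‖y‖ ^ 2) / 2 - ‖x + y‖ ^ 2 / 4 := by
      nlinarith [sq_nonneg (‖x‖ - ‖y‖)]
    -- If the difference is small, the left side is nonpositive. Otherwise `‖x - y‖ ≥ √ε * ‖x‖`, and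
    -- uniform convexity applies after scaling by `‖x‖⁻¹`.
    rcases le_or_gt (‖x - y‖ ^ 2) (ε * (‖x‖ ^ 2 + ‖y‖ ^ 2)) with h | h
    · refine le_trans ?_ hR
      exact mul_nonpos_of_nonneg_of_nonpos (by positivity) (by linarith)
    have hx : 0 < ‖x‖ := by
      by_contra hx
      have hx0 : ‖x‖ = 0 := le_antisymm (not_lt.1 hx) (norm_nonneg x)
      have hy0 : ‖y‖ = 0 := le_antisymm (hx0 ▸ hxy) hxy0
      rw [hx0, hy0] at h hsub
      norm_num at h hsub
      simp [hsub] at h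
    have hle : ‖x + y‖ ≤ (2 - d) * ‖x‖ := by
      have h1 : ‖‖x‖⁻¹ • x‖ ≤ 1 := by
        rw [norm_smul, norm_inv, norm_norm, inv_mul_cancel₀ hx.ne']
      have h2 : ‖‖x‖⁻¹ • y‖ ≤ 1 := by
        rw [norm_smul, norm_inv, norm_norm, inv_mul_le_iff₀ hx]; linarith
      have h3 : √ε ≤ ‖‖x‖⁻¹ • x - ‖x‖⁻¹ • y‖ := by
        rw [← smul_sub, norm_smul, norm_inv, norm_norm, le_inv_mul_iff₀ hx]
        refine le_of_sq_le_sq ?_ (norm_nonneg _)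
        rw [mul_pow, Real.sq_sqrt hε.le]
        nlinarith [sq_nonneg ‖y‖]
      have h4 := H h1 h2 h3
      rw [← smul_add, norm_smul, norm_inv, norm_norm, inv_mul_le_iff₀ hx] at h4
      nlinarith
    have hgap : d ^ 2 / 16 * ‖x‖ ^ 2 ≤ (‖x‖ ^ 2 + ‖y‖ ^ 2) / 2 - ‖x + y‖ ^ 2 / 4 := by
      -- If the norms differ substantially, the term `(‖x‖ - ‖y‖)² / 4` gives the gap; if they are
      -- close, the bound `hle` on the midpoint does.
      rcases le_total ‖y‖ ((1 - d / 2) * ‖x‖) with hy | hy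
      · have : (d / 2 * ‖x‖) ^ 2 ≤ (‖x‖ - ‖y‖) ^ 2 :=
          pow_le_pow_left₀ (by positivity) (by linarith) 2
        nlinarith
      · have h1 : ‖x + y‖ ^ 2 ≤ ((2 - d) * ‖x‖) ^ 2 := pow_le_pow_left₀ (norm_nonneg _) hle 2
        have h2 : (1 - d / 2) * ‖x‖ * ‖x‖ ≤ (‖x‖ ^ 2 + ‖y‖ ^ 2) / 2 := by
          nlinarith [sq_nonneg (‖x‖ - ‖y‖)]
        have h3 : 0 ≤ ‖x‖ ^ 2 := sq_nonneg _
        have h4 : 0 ≤ (1 - d / 2 - (2 - d) ^ 2 / 4 - d ^ 2 / 16) * ‖x‖ ^ 2 := by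
          refine mul_nonneg ?_ h3
          nlinarith
        nlinarith
    refine le_trans ?_ hgap
    have h1 : ‖x - y‖ ^ 2 ≤ 4 * ‖x‖ ^ 2 := by nlinarith
    have h2 : 0 ≤ ε * (‖x‖ ^ 2 + ‖y‖ ^ 2) := by positivity
    have h3 : ‖x - y‖ ^ 2 - ε * (‖x‖ ^ 2 + ‖y‖ ^ 2) ≤ 4 * ‖x‖ ^ 2 := by linarith
    have := mul_le_mul_of_nonneg_left h3 (by positivity : 0 ≤ d ^ 2 / 64)
    linarith
  intro x y
  rcases le_total ‖y‖ ‖x‖ with h | h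
  · exact key x y h
  · have := key y x h
    rwa [norm_sub_rev, add_comm y x, add_comm (‖y‖ ^ 2)] at this

/-- The inequality is linear in squared norms, so it is integrated pointwise with the same `δ`. -/
theorem meanL2 {Z : Type u} (M : MeanFunctional Z) {B : Type v} [NormedAddCommGroup B]
    [NormedSpace ℝ B] (h : QuadraticallyUniformlyConvex B) :
    QuadraticallyUniformlyConvex (MeanL2 M B) := by
  intro ε hε
  obtain ⟨δ, hδ, H⟩ := h ε hε
  refine ⟨δ, hδ, fun ξ η => ?_⟩
  have bξ := ξ.boundedReal_norm_sq
  have bη := η.boundedReal_norm_sq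
  have ba := (ξ + η).boundedReal_norm_sq
  have bs := (ξ - η).boundedReal_norm_sq
  have b1 := (bξ.add bη)
  have b2 := b1.const_mul (1 / 2 + δ * ε)
  have b3 := (bs.const_mul δ).add (ba.const_mul (1 / 4))
  have := M.mono' b3 b2 fun z => by
    have := H (ξ z) (η z)
    simp only [MeanL2.add_apply, MeanL2.sub_apply]
    linarith
  rw [M.add' (bs.const_mul δ) (ba.const_mul _), M.const_mul' _ bs, M.const_mul' _ ba,
    M.const_mul' _ b1, M.add' bξ bη] at this
  simp only [MeanL2.norm_sq_eq]
  linarith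

theorem completion {E : Type u} [SeminormedAddCommGroup E] (h : QuadraticallyUniformlyConvex E) :
    QuadraticallyUniformlyConvex (UniformSpace.Completion E) := by
  intro ε hε
  obtain ⟨δ, hδ, H⟩ := h ε hε
  refine ⟨δ, hδ, fun x y => ?_⟩
  refine UniformSpace.Completion.induction_on₂ x y ?_ fun a b => ?_
  · exact isClosed_le (by fun_prop) (by fun_prop)
  · rw [← UniformSpace.Completion.coe_sub, ← UniformSpace.Completion.coe_add]
    simpa only [UniformSpace.Completion.norm_coe] using H a b

end QuadraticallyUniformlyConvex

/-! ### From cocycles to affine isometric actions. -/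

open Filter Topology

/-- An action by isometries up to distance zero on a seminormed space induces an affine isometric
action on the completion. -/
theorem exists_affineIsometricAction_completion {G : Type u} [Group G] {E : Type v}
    [SeminormedAddCommGroup E] [NormedSpace ℝ E] (A : G → E → E) (hiso : ∀ g, Isometry (A g))
    (hone : ∀ ξ, dist (A 1 ξ) ξ = 0)
    (hmul : ∀ g h ξ, dist (A g (A h ξ)) (A (g * h) ξ) = 0) :
    ∃ α : G →* (UniformSpace.Completion E ≃ᵃⁱ[ℝ] UniformSpace.Completion E),
      ∀ (g : G) (ξ : E), α g ξ = (A g ξ : UniformSpace.Completion E) := by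
  -- The completion is Hausdorff, so group laws up to distance zero become exact.
  have hcoe : ∀ x y : E, dist x y = 0 → (x : UniformSpace.Completion E) = y := fun x y h => by
    rw [← dist_eq_zero, UniformSpace.Completion.dist_eq, h]
  let F : G → UniformSpace.Completion E → UniformSpace.Completion E :=
    fun g => UniformSpace.Completion.map (A g)
  have hF : ∀ g, Isometry (F g) := fun g => (hiso g).completion_map
  have hFcoe : ∀ g (ξ : E), F g ξ = (A g ξ : UniformSpace.Completion E) := fun g ξ =>
    UniformSpace.Completion.map_coe (hiso g).uniformContinuous ξ
  have hF1 : ∀ x, F 1 x = x := fun x =>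
    UniformSpace.Completion.induction_on x (isClosed_eq (hF 1).continuous continuous_id)
      fun ξ => by rw [hFcoe, hcoe _ _ (hone ξ)]
  have hFmul : ∀ g h x, F g (F h x) = F (g * h) x := fun g h x =>
    UniformSpace.Completion.induction_on x
      (isClosed_eq ((hF g).continuous.comp (hF h).continuous) (hF _).continuous)
      fun ξ => by rw [hFcoe, hFcoe, hFcoe, hcoe _ _ (hmul g h ξ)]
  -- Surjectivity comes from the group law, and Mazur–Ulam then makes each `F g` affine.
  refine ⟨{ toFun := fun g => (IsometryEquiv.mk' (F g) (F g⁻¹)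
              (fun x => by rw [hFmul, mul_inv_cancel, hF1]) (hF g)).toRealAffineIsometryEquiv
            map_one' := ?_
            map_mul' := fun g h => ?_ }, fun g ξ => hFcoe g ξ⟩
  · ext x
    exact hF1 x
  · ext x
    exact (hFmul g h x).symm

/-- The ultralimit of finitely additive probability measures, on the disjoint union. -/
theorem FinAddProb.exists_ultralimit {Y : ℕ → Type u} (ν : ∀ k, FinAddProb (Y k)) :
    ∃ μ : FinAddProb (Σ k, Y k), ∀ A,
      Tendsto (fun k => (ν k).toFun (Sigma.mk k ⁻¹' A)) (hyperfilter ℕ) (𝓝 (μ.toFun A)) := by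
  have h : ∀ A : Set (Σ k, Y k), ∃ t : ℝ,
      Tendsto (fun k => (ν k).toFun (Sigma.mk k ⁻¹' A)) (hyperfilter ℕ) (𝓝 t) := by
    intro A
    obtain ⟨t, -, ht⟩ := isCompact_Icc.ultrafilter_le_nhds
      ((hyperfilter ℕ).map fun k => (ν k).toFun (Sigma.mk k ⁻¹' A))
      (le_principal_iff.2 (Ultrafilter.mem_coe.2 (Ultrafilter.mem_map.2
        (Filter.univ_mem' fun k => (ν k).mem_Icc (Sigma.mk k ⁻¹' A)))))
    exact ⟨t, ht⟩
  choose m hm using h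
  refine ⟨⟨m, fun A => ?_, ?_, fun A B hAB => ?_⟩, hm⟩
  · exact ge_of_tendsto (hm A) (Eventually.of_forall fun k => (ν k).nonneg' _)
  · refine tendsto_nhds_unique (hm Set.univ) ?_
    simp only [Set.preimage_univ, (ν _).univ']
    exact tendsto_const_nhds
  · refine tendsto_nhds_unique (hm (A ∪ B)) (((hm A).add (hm B)).congr fun k => ?_)
    rw [Set.preimage_union, (ν k).union' _ _ (hAB.preimage _)]

theorem MeanL2.dist_eq_zero_of_null {Z : Type u} {B : Type v} [NormedAddCommGroup B]
    [NormedSpace ℝ B] {M : MeanFunctional Z} {ξ η : MeanL2 M B} {A : Set Z}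
    (hA : M.toFun (A.indicator fun _ => 1) = 0) (h : ∀ z ∉ A, ξ z = η z) : dist ξ η = 0 := by
  have hb := (ξ - η).boundedReal_norm_sq
  have := M.congr_of_null hb (BoundedReal.const 0) hA fun z hz => by simp [h z hz]
  rw [M.const] at this
  rw [dist_eq_norm, MeanL2.norm_eq, this, Real.sqrt_zero]

/-- A cocycle, up to null sets, of isometries of a uniformly convex space over a measure preserving
action induces an affine isometric action on a uniformly convex Banach space. -/
theorem exists_affineIsometricAction_of_cocycle {G : Type w} [Group G] {Z : Type u}
    (μ : FinAddProb Z) {B : Type v} [NormedAddCommGroup B] [NormedSpace ℝ B] [UniformConvexSpace B]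
    (act : G → Z ≃ Z) (hact : ∀ g h z, act (g * h) z = act h (act g z))
    (hμ : ∀ g A, μ.toFun (act g ⁻¹' A) = μ.toFun A)
    (U : G → Z → B → B) (hU : ∀ g z, Isometry (U g z)) (hUb : ∀ g, ∃ C, ∀ z, ‖U g z 0‖ ≤ C)
    (hU1 : ∀ z v, U 1 z v = v)
    (hUmul : ∀ g h, ∃ A, μ.toFun A = 0 ∧
      ∀ z ∉ A, ∀ v, U g z (U h (act g z) v) = U (g * h) z v)
    (c : G → ℝ) (hc : ∀ g, ∃ A, μ.toFun A = 0 ∧ ∀ z ∉ A, c g ≤ ‖U g z 0‖) :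
    ∃ (E : Type max u v) (_ : NormedAddCommGroup E) (_ : NormedSpace ℝ E),
      CompleteSpace E ∧ UniformConvexSpace E ∧
        ∃ α : G →* (E ≃ᵃⁱ[ℝ] E), ∀ g, c g ≤ ‖α g 0‖ := by
  have hact1 : ∀ z, act 1 z = z := fun z => (act 1).injective (by rw [← hact, mul_one])
  have hbound : ∀ g (ξ : MeanL2 μ.mean B), ∃ C, ∀ z, ‖U g z (ξ (act g z))‖ ≤ C := by
    intro g ξ
    obtain ⟨C, hC⟩ := hUb g
    obtain ⟨D, hD⟩ := ξ.2
    refine ⟨D + C, fun z => ?_⟩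
    have h := norm_le_norm_sub_add (U g z (ξ (act g z))) (U g z 0)
    rw [← dist_eq_norm, (hU g z).dist_eq, dist_zero_right] at h
    exact h.trans (add_le_add (hD _) (hC z))
  let T : G → MeanL2 μ.mean B → MeanL2 μ.mean B :=
    fun g ξ => ⟨fun z => U g z (ξ (act g z)), hbound g ξ⟩
  have hT : ∀ g ξ z, T g ξ z = U g z (ξ (act g z)) := fun _ _ _ => rfl
  obtain ⟨α, hα⟩ := exists_affineIsometricAction_completion T
    (fun g => Isometry.of_dist_eq fun ξ η => by
      simp only [MeanL2.dist_eq, hT, (hU _ _).dist_eq]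
      rw [μ.mean_comp (act g) (hμ g) fun z => dist (ξ z) (η z) ^ 2])
    (fun ξ => MeanL2.dist_eq_zero_of_null (A := ∅) (by rw [μ.mean_indicator, μ.empty])
      fun z _ => by rw [hT, hU1, hact1])
    (fun g h ξ => by
      obtain ⟨A, hA, hA'⟩ := hUmul g h
      refine MeanL2.dist_eq_zero_of_null (A := A) (by rw [μ.mean_indicator, hA]) fun z hz => ?_
      rw [hT, hT, hT, hA' z hz, hact])
  refine ⟨UniformSpace.Completion (MeanL2 μ.mean B), inferInstance, inferInstance, inferInstance,
    ((QuadraticallyUniformlyConvex.of_uniformConvexSpace B).meanL2 _).completion.uniformConvexSpace,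
    α, fun g => ?_⟩
  rw [← UniformSpace.Completion.coe_zero, hα, UniformSpace.Completion.norm_coe]
  -- The comparison below squares `c g`, which may be negative.
  rcases le_total (c g) 0 with h0 | h0
  · exact h0.trans (norm_nonneg _)
  obtain ⟨A, hA, hA'⟩ := hc g
  refine le_of_sq_le_sq ?_ (norm_nonneg _)
  rw [MeanL2.norm_sq_eq, ← μ.mean.const (c g ^ 2)]
  refine μ.mean.mono_of_null (.const _) (MeanL2.boundedReal_norm_sq _) (A := A)
    (by rw [μ.mean_indicator, hA]) fun z hz => ?_
  rw [hT, MeanL2.zero_apply]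
  exact pow_le_pow_left₀ h0 (hA' z hz) 2

/-! ### Local geometry of the quotients. -/

namespace BoxFamily

variable {G : Type u} [Group G] (X : BoxFamily G)

theorem antitone_subgroup : Antitone X.subgroup := antitone_nat_of_succ_le X.succ_le

/-- Each nontrivial element eventually leaves the decreasing subgroups, and a ball contains only
finitely many elements. -/
theorem eventually_eq_one (R : ℝ) :
    ∃ n₀, ∀ n ≥ n₀, ∀ g ∈ X.subgroup n, X.length.toGroupNorm g ≤ R → g = 1 := by
  have h : ∀ᶠ n in atTop, ∀ g ∈ {g : G | X.length.toGroupNorm g ≤ R},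
      g ∈ X.subgroup n → g = 1 := by
    have hfin : {g : G | X.length.toGroupNorm g ≤ R}.Finite := X.length.finite_ball R
    rw [eventually_all_finite hfin]
    intro g _
    by_cases hg : g = 1
    · exact Eventually.of_forall fun _ _ => hg
    · have : ∃ n, g ∉ X.subgroup n := by
        by_contra! hall
        have : g ∈ ⨅ n, X.subgroup n := Subgroup.mem_iInf.2 hall
        rw [X.iInf_eq_bot] at this
        exact hg (Subgroup.mem_bot.1 this)
      obtain ⟨n, hn⟩ := this
      filter_upwards [eventually_ge_atTop n] with m hm hgm
      exact absurd (X.antitone_subgroup hm hgm) hn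
  obtain ⟨n₀, hn₀⟩ := eventually_atTop.1 h
  exact ⟨n₀, fun n hn g hg hgR => hn₀ n hn g hgR hg⟩

theorem quotientLength_nonneg (n : ℕ) (q : G ⧸ X.subgroup n) :
    0 ≤ X.length.quotientLength (X.subgroup n) q := by
  obtain ⟨g, -, hg⟩ := X.length.exists_quotientLength_eq (X.subgroup n) q
  exact hg ▸ apply_nonneg X.length.toGroupNorm g

/-- In the range where the subgroup meets a ball trivially, an element of small length whose
class has small length is the unique minimal representative of its class. -/
theorem eq_of_mk_eq {n : ℕ} {R S : ℝ}
    (h : ∀ g ∈ X.subgroup n, X.length.toGroupNorm g ≤ R + S → g = 1) {a b : G}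
    (ha : X.length.toGroupNorm a ≤ R) (hb : X.length.toGroupNorm b ≤ S)
    (hab : (a : G ⧸ X.subgroup n) = b) : a = b := by
  refine inv_mul_eq_one.1 (h _ (QuotientGroup.eq.1 hab) ?_)
  refine (map_mul_le_add _ _ _).trans (add_le_add ?_ hb)
  rwa [map_inv_eq_map]

/-- A minimal representative of the class of `g` is no longer than `g`, so it equals `g` once `G_n`
meets the ball of radius `2 l(g)` trivially. -/
theorem eventually_quotientLength_eq (g : G) :
    ∃ n₀, ∀ n ≥ n₀, X.length.quotientLength (X.subgroup n) g = X.length.toGroupNorm g := by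
  obtain ⟨n₀, hn₀⟩ :=
    X.eventually_eq_one (X.length.toGroupNorm g + X.length.toGroupNorm g)
  refine ⟨n₀, fun n hn => ?_⟩
  obtain ⟨a, ha, hla⟩ := X.length.exists_quotientLength_eq (X.subgroup n) g
  rw [← hla, X.eq_of_mk_eq (hn₀ n hn) (hla ▸ X.length.quotientLength_le _ g) le_rfl ha]

end BoxFamily

/-! ### From a fibred embedding to a proper action. -/

/-- The parallel transport of a fibred embedding, read in fixed identifications of the fibres with
the model space that map the section to zero. -/
theorem AdmitsFibredCofinitelyCoarseEmbedding.exists_transport {ι : Type w} {X : ι → Type u}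
    [∀ i, MetricSpace (X i)] {B : Type v} [NormedAddCommGroup B]
    (h : AdmitsFibredCofinitelyCoarseEmbedding X B) :
    ∃ ρ₁ ρ₂ : ℝ → ℝ, Tendsto ρ₁ atTop atTop ∧ MonotoneOn ρ₂ (Set.Ici 0) ∧
      ∀ r : ℝ, 0 < r → ∃ K : Finset ι, ∀ i ∉ K, ∃ V : X i → X i → B → B,
        (∀ x y, Isometry (V x y)) ∧ (∀ x v, V x x v = v) ∧
        (∀ x y, dist x y < r → ρ₁ (dist x y) ≤ ‖V x y 0‖ ∧ ‖V x y 0‖ ≤ ρ₂ (dist x y)) ∧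
        ∀ x y z, dist x y < r → dist y z < r → dist x z < r → ∀ v, V x y (V y z v) = V x z v := by
  obtain ⟨F, _, s, ρ₁, ρ₂, hF, -, hρ₁, hρ₂, -, H⟩ := h
  refine ⟨ρ₁, ρ₂, hρ₁, hρ₂, fun r hr => ?_⟩
  obtain ⟨K, t, ht⟩ := H r hr
  refine ⟨K, fun i hi => ?_⟩
  obtain ⟨hcoarse, hT⟩ := ht i hi
  have hτ : ∀ x, ∃ τ : F i x ≃ᵢ B, τ (s i x) = 0 := fun x => by
    obtain ⟨e⟩ := hF i x
    exact ⟨e.trans (IsometryEquiv.addRight (-e (s i x))), by simp⟩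
  choose τ hτ using hτ
  have hτs : ∀ x, (τ x).symm 0 = s i x := fun x => by rw [← hτ x, IsometryEquiv.symm_apply_apply]
  -- Replacing `C'` by `C` changes both trivializations by the same map `T`, which cancels:
  -- transport does not depend on the set used. Hence three pairwise transports can be compared
  -- inside `{x, y, z}`.
  have hflat : ∀ C C' : Set (X i), Metric.ediam C < ENNReal.ofReal r →
      Metric.ediam C' < ENNReal.ofReal r → ∀ x y, x ∈ C ∩ C' → y ∈ C ∩ C' → ∀ v : F i y,
        (t i C x).symm (t i C y v) = (t i C' x).symm (t i C' y v) := by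
    intro C C' hC hC' x y hx hy v
    obtain ⟨T, -, hT⟩ := hT C C' hC hC' ⟨x, hx⟩
    have h1 := hT y hy (t i C' y v)
    have h2 := hT x hx (t i C' y v)
    rw [IsometryEquiv.symm_apply_apply] at h1
    rw [h1, ← h2, IsometryEquiv.symm_apply_apply]
  have hed : ∀ x y : X i, dist x y < r → edist x y < ENNReal.ofReal r := fun x y h => by
    rw [edist_dist]; exact (ENNReal.ofReal_lt_ofReal_iff hr).2 h
  have hpair : ∀ x y : X i, dist x y < r → Metric.ediam {x, y} < ENNReal.ofReal r :=
    fun x y h => by rw [Metric.ediam_pair]; exact hed x y h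
  refine ⟨fun x y v => τ x ((t i {x, y} x).symm (t i {x, y} y ((τ y).symm v))),
    fun x y => ?_, fun x v => by simp, fun x y hxy => ?_, fun x y z hxy hyz hxz v => ?_⟩
  · exact (τ x).isometry.comp ((t i {x, y} x).symm.isometry.comp
      ((t i {x, y} y).isometry.comp (τ y).symm.isometry))
  · have := hcoarse {x, y} (hpair x y hxy) x (by simp) y (by simp)
    dsimp only
    rw [hτs, ← dist_zero_right, ← hτ x, (τ x).dist_eq,
      ← (t i {x, y} x).dist_eq, IsometryEquiv.apply_symm_apply, dist_comm (t i {x, y} y _)]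
    exact this
  · have hC : Metric.ediam {x, y, z} < ENNReal.ofReal r := by
      rw [Metric.ediam_triple]
      exact max_lt (max_lt (hed _ _ hxy) (hed _ _ hxz)) (hed _ _ hyz)
    simp only [IsometryEquiv.symm_apply_apply]
    rw [hflat {x, y} {x, y, z} (hpair _ _ hxy) hC x y (by simp) (by simp),
      hflat {y, z} {x, y, z} (hpair _ _ hyz) hC y z (by simp) (by simp),
      hflat {x, z} {x, y, z} (hpair _ _ hxz) hC x z (by simp) (by simp),
      IsometryEquiv.apply_symm_apply]

/-- The orbits of `ξ` and `0` stay at distance `‖ξ‖`, so growth of the orbit of `0` suffices. -/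
theorem isProperAffineAction_of_le {G : Type u} [Group G] (l : ProperLength G) {E : Type v}
    [NormedAddCommGroup E] [NormedSpace ℝ E] (α : G →* (E ≃ᵃⁱ[ℝ] E)) {ρ : ℝ → ℝ}
    (hρ : Tendsto ρ atTop atTop) (h : ∀ g, ρ (l.toGroupNorm g) ≤ ‖α g 0‖) :
    IsProperAffineAction α := by
  intro ξ A hA
  obtain ⟨C, hC⟩ := hA.exists_norm_le
  obtain ⟨R, hR⟩ := eventually_atTop.1 (hρ.eventually_gt_atTop (‖ξ‖ + C))
  refine (l.finite_ball R).subset fun g hg => ?_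
  by_contra hlt
  have h1 := hR (l.toGroupNorm g) (not_le.1 hlt).le
  have h2 := h g
  have h3 : ‖α g 0‖ ≤ ‖α g 0 - α g ξ‖ + ‖α g ξ‖ := norm_le_norm_sub_add _ _
  rw [← dist_eq_norm, (α g).dist_map, dist_zero_left] at h3
  linarith [hC _ hg]

/-- A box family that embeds in a uniformly convex Banach space yields a proper action. -/
theorem BoxFamily.EmbedsInUniformlyConvex.actsProperly {G : Type u} [Group G] {X : BoxFamily G}
    (h : X.EmbedsInUniformlyConvex) : ActsProperlyOnUniformlyConvex G := by
  obtain ⟨B, _, _, -, _, hemb⟩ := h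
  obtain ⟨ρ₁, ρ₂, hρ₁, hρ₂, H⟩ := hemb.exists_transport
  have Hk : ∀ k : ℕ, ∃ n ≥ k, ∃ V : G ⧸ X.subgroup n → G ⧸ X.subgroup n → B → B,
      (∀ x y, Isometry (V x y)) ∧ (∀ x v, V x x v = v) ∧
      (∀ x y, X.length.quotientLength (X.subgroup n) (x⁻¹ * y) < (k : ℝ) + 1 →
        ρ₁ (X.length.quotientLength (X.subgroup n) (x⁻¹ * y)) ≤ ‖V x y 0‖ ∧
        ‖V x y 0‖ ≤ ρ₂ (X.length.quotientLength (X.subgroup n) (x⁻¹ * y))) ∧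
      ∀ x y z, X.length.quotientLength (X.subgroup n) (x⁻¹ * y) < (k : ℝ) + 1 →
        X.length.quotientLength (X.subgroup n) (y⁻¹ * z) < (k : ℝ) + 1 →
        X.length.quotientLength (X.subgroup n) (x⁻¹ * z) < (k : ℝ) + 1 →
        ∀ v, V x y (V y z v) = V x z v := by
    intro k
    obtain ⟨K, hK⟩ := H ((k : ℝ) + 1) (by positivity)
    -- An index at least `k` and beyond the exceptional set `K`.
    refine ⟨k + K.sup id + 1, by omega, hK _ fun hmem => ?_⟩
    have := Finset.le_sup (f := id) hmem
    simp only [id] at this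
    omega
  choose n hn V hViso hVone hVcoarse hVmul using Hk
  choose m hm0 hm1 hmu hminv using X.amenable
  obtain ⟨μ, hμ⟩ := FinAddProb.exists_ultralimit fun k =>
    (⟨m (n k), hm0 _, hm1 _, hmu _⟩ : FinAddProb (G ⧸ X.subgroup (n k)))
  let act : G → (Σ k, G ⧸ X.subgroup (n k)) ≃ (Σ k, G ⧸ X.subgroup (n k)) :=
    fun g => Equiv.sigmaCongrRight fun k => Equiv.mulRight (g : G ⧸ X.subgroup (n k))
  -- The ultrafilter is nonprincipal, so for each group element the finitely many scales that are
  -- too small do not count.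
  have hnull : ∀ k₀ : ℕ, μ.toFun {z | z.1 < k₀} = 0 := by
    intro k₀
    refine tendsto_nhds_unique (hμ _) (tendsto_const_nhds.congr' ?_)
    filter_upwards [Nat.hyperfilter_le_atTop (eventually_ge_atTop k₀)] with k hk
    have : (Sigma.mk k ⁻¹' {z : Σ k, G ⧸ X.subgroup (n k) | z.1 < k₀}) = ∅ := by
      ext x; simpa using hk
    rw [this]
    exact (FinAddProb.empty ⟨m (n k), hm0 _, hm1 _, hmu _⟩).symm
  let len : ∀ (_ : ℕ) (_ : G), ℝ := fun k g => X.length.quotientLength (X.subgroup (n k)) g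
  have hlen : ∀ k g, len k g ≤ X.length.toGroupNorm g := fun k g => X.length.quotientLength_le _ g
  have hlen0 : ∀ k g, 0 ≤ len k g := fun k g => X.quotientLength_nonneg (n k) g
  have hdist : ∀ (k : ℕ) (g : G) (x : G ⧸ X.subgroup (n k)),
      X.length.quotientLength (X.subgroup (n k)) (x⁻¹ * (x * (g : G ⧸ X.subgroup (n k))))
        = len k g := fun k g x => by rw [inv_mul_cancel_left]
  classical
  -- At scales too small for `g` nothing bounds `V`; the identity there keeps `U g z 0` bounded
  -- uniformly in `z`.
  let U : G → (Σ k, G ⧸ X.subgroup (n k)) → B → B := fun g z v =>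
    if len z.1 g < (z.1 : ℝ) + 1 then V z.1 z.2 (z.2 * (g : G ⧸ X.subgroup (n z.1))) v else v
  have hUpos : ∀ g k (x : G ⧸ X.subgroup (n k)) v, len k g < (k : ℝ) + 1 →
      U g ⟨k, x⟩ v = V k x (x * (g : G ⧸ X.subgroup (n k))) v := fun g k x v hk => if_pos hk
  have hUneg : ∀ g k (x : G ⧸ X.subgroup (n k)) v, ¬ len k g < (k : ℝ) + 1 →
      U g ⟨k, x⟩ v = v := fun g k x v hk => if_neg hk
  have hsmall : ∀ (R : ℝ) (k : ℕ), ¬ k < ⌈R⌉₊ → R < (k : ℝ) + 1 := fun R k hk => by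
    have : ((⌈R⌉₊ : ℕ) : ℝ) ≤ k := by exact_mod_cast not_lt.1 hk
    linarith [Nat.le_ceil R]
  obtain ⟨E, _, _, hE, hE', α, hα⟩ := exists_affineIsometricAction_of_cocycle μ act
    (fun g h z => by
      obtain ⟨k, x⟩ := z
      simp [act, mul_assoc])
    (fun g A => by
      refine tendsto_nhds_unique (hμ _) ((hμ A).congr fun k => ?_)
      change m (n k) _ = m (n k) ((fun x => x * (g : G ⧸ X.subgroup (n k))) ⁻¹'
        ((fun x => (⟨k, x⟩ : Σ k, G ⧸ X.subgroup (n k))) ⁻¹' A))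
      rw [← hminv (n k) _ (g : G ⧸ X.subgroup (n k))⁻¹, Set.image_mul_right, inv_inv])
    U
    (fun g ⟨k, x⟩ => by
      by_cases hk : len k g < (k : ℝ) + 1
      · rw [funext fun v => hUpos g k x v hk]; exact hViso _ _ _
      · rw [funext fun v => hUneg g k x v hk]; exact isometry_id)
    (fun g => by
      refine ⟨max 0 (ρ₂ (X.length.toGroupNorm g)), fun ⟨k, x⟩ => ?_⟩
      by_cases hk : len k g < (k : ℝ) + 1
      · rw [hUpos g k x 0 hk]
        refine (hVcoarse k _ _ (by rwa [hdist])).2.trans ?_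
        rw [hdist]
        exact (hρ₂ (hlen0 k g) ((hlen0 k g).trans (hlen k g)) (hlen k g)).trans (le_max_right _ _)
      · rw [hUneg g k x 0 hk, norm_zero]
        exact le_max_left _ _)
    (fun ⟨k, x⟩ v => by
      by_cases hk : len k 1 < (k : ℝ) + 1
      · rw [hUpos 1 k x v hk, QuotientGroup.mk_one, mul_one, hVone]
      · exact hUneg 1 k x v hk)
    (fun g h => by
      refine ⟨_, hnull ⌈X.length.toGroupNorm g + X.length.toGroupNorm h⌉₊, fun ⟨k, x⟩ hz v => ?_⟩
      have hR := hsmall _ k hz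
      have hg0 : 0 ≤ X.length.toGroupNorm g := apply_nonneg _ _
      have hh0 : 0 ≤ X.length.toGroupNorm h := apply_nonneg _ _
      have h1 : len k g < (k : ℝ) + 1 := by linarith [hlen k g]
      have h2 : len k h < (k : ℝ) + 1 := by linarith [hlen k h]
      have h3 : len k (g * h) < (k : ℝ) + 1 := by
        have : X.length.toGroupNorm (g * h) ≤ _ := map_mul_le_add _ g h
        linarith [hlen k (g * h)]
      have hact : act g ⟨k, x⟩ = ⟨k, x * (g : G ⧸ X.subgroup (n k))⟩ := rfl
      rw [hact, hUpos g k x _ h1, hUpos h k _ _ h2, hUpos (g * h) k x _ h3, QuotientGroup.mk_mul,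
        ← mul_assoc]
      refine hVmul k _ _ _ (by rwa [hdist]) (by rwa [hdist]) ?_ v
      rwa [mul_assoc, ← QuotientGroup.mk_mul, hdist])
    (fun g => ρ₁ (X.length.toGroupNorm g))
    (fun g => by
      obtain ⟨n₀, hn₀⟩ := X.eventually_quotientLength_eq g
      refine ⟨_, hnull (max n₀ ⌈X.length.toGroupNorm g⌉₊), fun ⟨k, x⟩ hz => ?_⟩
      have hz' : max n₀ ⌈X.length.toGroupNorm g⌉₊ ≤ k := not_lt.1 hz
      have h1 : len k g = X.length.toGroupNorm g :=
        hn₀ _ (((le_max_left _ _).trans hz').trans (hn k))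
      have h2 : len k g < (k : ℝ) + 1 :=
        h1 ▸ hsmall _ k (not_lt.2 ((le_max_right _ _).trans hz'))
      rw [hUpos g k x 0 h2]
      have := (hVcoarse k x (x * (g : G ⧸ X.subgroup (n k))) (by rwa [hdist])).1
      rwa [hdist, h1] at this)
  exact ⟨E, ‹_›, ‹_›, hE, hE', α, isProperAffineAction_of_le X.length α hρ₁ hα⟩

/-! ### From a proper action to fibred embeddings. -/

namespace ProperLength

variable {G : Type u} [Group G] (l : ProperLength G)

/-- Take `ρ t = inf_g (c g + max (t - l g) 0)`. If `D` bounds the lengths of the finitely many `g`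
with `c g ≤ R`, then `ρ t ≥ R` for `t ≥ R + D`. -/
theorem exists_lower_control {c : G → ℝ} (hc : ∀ g, 0 ≤ c g) (hfin : ∀ R, {g | c g ≤ R}.Finite) :
    ∃ ρ : ℝ → ℝ, Monotone ρ ∧ Tendsto ρ atTop atTop ∧ ∀ g, ρ (l.toGroupNorm g) ≤ c g := by
  have hbdd : ∀ t : ℝ, BddBelow (Set.range fun g => c g + max (t - l.toGroupNorm g) 0) := by
    intro t
    refine ⟨0, ?_⟩
    rintro _ ⟨g, rfl⟩
    exact add_nonneg (hc g) (le_max_right _ _)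
  refine ⟨fun t => ⨅ g, (c g + max (t - l.toGroupNorm g) 0), fun a b hab => ?_, ?_, fun g => ?_⟩
  · exact ciInf_mono (hbdd a) fun g => by gcongr
  · refine tendsto_atTop.2 fun R => ?_
    obtain ⟨D, hD⟩ := ((hfin R).image l.toGroupNorm).bddAbove
    filter_upwards [eventually_ge_atTop (R + D)] with t ht
    refine le_ciInf fun g => ?_
    rcases le_or_gt (c g) R with h | h
    · have h1 := hD ⟨g, h, rfl⟩
      have h2 := le_max_left (t - l.toGroupNorm g) 0
      linarith [hc g]
    · have h2 := le_max_right (t - l.toGroupNorm g) 0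
      linarith
  · refine (ciInf_le (hbdd _) g).trans ?_
    simp

/-- The supremum of `c` over a finite ball, plus `t` to force divergence. -/
theorem exists_upper_control {c : G → ℝ} (hc : ∀ g, 0 ≤ c g) :
    ∃ ρ : ℝ → ℝ, MonotoneOn ρ (Set.Ici 0) ∧ Tendsto ρ atTop atTop ∧
      ∀ g, c g ≤ ρ (l.toGroupNorm g) := by
  have hbdd : ∀ t : ℝ, BddAbove (c '' {g | l.toGroupNorm g ≤ t}) := fun t =>
    ((l.finite_ball t).image c).bddAbove
  refine ⟨fun t => t + sSup (c '' {g | l.toGroupNorm g ≤ t}), fun a ha b _ hab => ?_, ?_,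
    fun g => ?_⟩
  · refine add_le_add hab (csSup_le_csSup (hbdd b) ⟨c 1, 1, ?_, rfl⟩ (Set.image_mono ?_))
    · change l.toGroupNorm 1 ≤ a
      rw [map_one_eq_zero]
      exact ha
    · exact fun g hg => le_trans hg hab
  · refine tendsto_atTop_mono (fun t => ?_) tendsto_id
    have : 0 ≤ sSup (c '' {g | l.toGroupNorm g ≤ t}) := Real.sSup_nonneg (by
      rintro _ ⟨g, -, rfl⟩
      exact hc g)
    simpa using this
  · have h1 : c g ≤ sSup (c '' {h | l.toGroupNorm h ≤ l.toGroupNorm g}) :=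
      le_csSup (hbdd _) ⟨g, le_refl (l.toGroupNorm g), rfl⟩
    have h2 : 0 ≤ l.toGroupNorm g := apply_nonneg _ _
    linarith

end ProperLength

/-- A proper action on a uniformly convex Banach space yields fibred embeddings of all box
families. -/
theorem ActsProperlyOnUniformlyConvex.embeds {G : Type u} [Group G]
    (h : ActsProperlyOnUniformlyConvex G) (X : BoxFamily G) : X.EmbedsInUniformlyConvex := by
  obtain ⟨B, _, _, hB, hB', α, hα⟩ := h
  refine ⟨B, ‹_›, ‹_›, hB, hB', ?_⟩
  have hfin : ∀ R, {g | ‖α g 0‖ ≤ R}.Finite := fun R => by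
    refine (hα 0 (Metric.closedBall 0 R) Metric.isBounded_closedBall).subset fun g hg => ?_
    simpa using hg
  obtain ⟨ρ₁, hm₁, ht₁, hρ₁⟩ := X.length.exists_lower_control (fun g => norm_nonneg (α g 0)) hfin
  obtain ⟨ρ₂, hm₂, ht₂, hρ₂⟩ := X.length.exists_upper_control (fun g => norm_nonneg (α g 0))
  have hmul : ∀ (a b : G) (v : B), α (a * b) v = α a (α b v) := fun a b v => by
    rw [map_mul]; rfl
  choose u hu hul using fun n => X.length.exists_quotientLength_eq (X.subgroup n)
  have hbase : ∀ (n : ℕ) (C : Set (G ⧸ X.subgroup n)), ∃ b, C.Nonempty → b ∈ C := fun n C => by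
    by_cases hC : C.Nonempty
    · exact ⟨hC.some, fun _ => hC.some_mem⟩
    · exact ⟨1, fun h => absurd h hC⟩
  choose b hb using hbase
  let diff : ∀ n, G ⧸ X.subgroup n → G ⧸ X.subgroup n → G := fun n x y => u n (x⁻¹ * y)
  let lift : ∀ n, Set (G ⧸ X.subgroup n) → G ⧸ X.subgroup n → G := fun n C x => diff n (b n C) x
  -- The difference of two lifts and the minimal representative `diff n x x'` lie in the same coset,
  -- with lengths at most `2r` and `r`; trivial intersection with the `3r`-ball makes them equal.
  have hlift : ∀ (r : ℝ) (n : ℕ),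
      (∀ g ∈ X.subgroup n, X.length.toGroupNorm g ≤ r + r + r → g = 1) →
      ∀ C : Set (G ⧸ X.subgroup n),
        (∀ y ∈ C, ∀ y' ∈ C, X.length.toGroupNorm (diff n y y') ≤ r) →
        ∀ x ∈ C, ∀ x' ∈ C, lift n C x' = lift n C x * diff n x x' := by
    intro r n hn C hlen x hx x' hx'
    have hbC : b n C ∈ C := hb n C ⟨x, hx⟩
    have key : (diff n (b n C) x)⁻¹ * diff n (b n C) x' = diff n x x' := by
      refine X.eq_of_mk_eq (R := r + r) (S := r) hn ?_ (hlen x hx x' hx') ?_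
      · refine (map_mul_le_add _ _ _).trans (add_le_add ?_ (hlen _ hbC _ hx'))
        rw [map_inv_eq_map]
        exact hlen _ hbC _ hx
      · simp only [diff, QuotientGroup.mk_mul, QuotientGroup.mk_inv, hu]
        group
    rw [← key, mul_inv_cancel_left]
  have hdiam : ∀ (r : ℝ) (n : ℕ), 0 < r → ∀ C : Set (X.Space n),
      Metric.ediam C < ENNReal.ofReal r → ∀ y ∈ C, ∀ y' ∈ C,
        X.length.toGroupNorm (diff n y y') ≤ r := by
    intro r n hr C hC y hy y' hy'
    have h1 := (Metric.edist_le_ediam_of_mem hy hy').trans_lt hC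
    rw [edist_dist, ENNReal.ofReal_lt_ofReal_iff hr] at h1
    exact (hul n _).trans_le h1.le
  refine ⟨fun _ _ => B, fun _ _ => inferInstance, fun _ _ => 0, ρ₁, ρ₂,
    fun _ _ => ⟨IsometryEquiv.refl B⟩, hm₁.monotoneOn _, ht₁, hm₂, ht₂, fun r hr => ?_⟩
  obtain ⟨n₀, hn₀⟩ := X.eventually_eq_one (r + r + r)
  refine ⟨Finset.range n₀, fun n C x => (α (lift n C x)).toIsometryEquiv,
    fun n hn => ?_⟩
  have hlift := fun (C : Set (X.Space n)) (hC : Metric.ediam C < ENNReal.ofReal r) =>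
    hlift r n (hn₀ n (by simpa using hn)) C (hdiam r n hr C hC)
  refine ⟨fun C hC x hx x' hx' => ?_, fun C₁ C₂ hC₁ hC₂ ⟨z, hz⟩ => ?_⟩
  · have hd : dist x x' =
        X.length.toGroupNorm (diff n x x') := (hul n _).symm
    change ρ₁ (dist x x') ≤ dist (α (lift n C x) 0) (α (lift n C x') 0) ∧
      dist (α (lift n C x) 0) (α (lift n C x') 0) ≤ ρ₂ (dist x x')
    have he : dist (α (lift n C x) 0) (α (lift n C x') 0) =
        ‖α (diff n x x') 0‖ := by
      rw [hlift C hC x hx x' hx', hmul (lift n C x), (α _).dist_map, dist_zero_left]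
    rw [he, hd]
    exact ⟨hρ₁ _, hρ₂ _⟩
  -- Passing from `z` to `x` multiplies both lifts on the right by `diff n z x`, which cancels in
  -- this product.
  · refine ⟨α (lift n C₁ z * (lift n C₂ z)⁻¹), (α _).isometry, fun x hx y => ?_⟩
    have hsymm : (α (lift n C₂ x)).toIsometryEquiv.symm y = α (lift n C₂ x)⁻¹ y := by
      rw [map_inv]; rfl
    change α (lift n C₁ x) ((α (lift n C₂ x)).toIsometryEquiv.symm y) = _
    rw [hsymm, ← hmul (lift n C₁ x), hlift C₁ hC₁ z hz.1 x hx.1, hlift C₂ hC₂ z hz.2 x hx.2]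
    congr 2
    group

/-! ### Existence of a proper length function, and the conclusion. -/

/-- Every countable group carries a proper length function. -/
theorem nonempty_properLength (G : Type u) [Group G] [Countable G] : Nonempty (ProperLength G) := by
  obtain ⟨e, he⟩ := exists_injective_nat G
  -- Symmetric weights with finite sublevel sets; the length is the least total weight of a word.
  -- The `+ 1` makes every letter cost something, so only the empty word has weight zero and balls
  -- are finite by induction on the radius.
  let w : G → ℕ := fun g => min (e g) (e g⁻¹) + 1
  have hw : ∀ g, w g⁻¹ = w g := fun g => by simp [w, min_comm]
  have hwfin : ∀ N, {g | w g ≤ N}.Finite := by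
    intro N
    refine (((Set.finite_Iic N).preimage he.injOn).union
      ((Set.finite_Iic N).preimage (he.comp inv_injective).injOn)).subset fun g hg => ?_
    have hg' : min (e g) (e g⁻¹) + 1 ≤ N := hg
    simp only [Set.mem_union, Set.mem_preimage, Set.mem_Iic, Function.comp]
    omega
  let S : G → Set ℕ := fun g => {n | ∃ L : List G, L.prod = g ∧ (L.map w).sum = n}
  have hS : ∀ g, (S g).Nonempty := fun g => ⟨w g, [g], by simp, by simp⟩
  have hle : ∀ L : List G, sInf (S L.prod) ≤ (L.map w).sum := fun L => Nat.sInf_le ⟨L, rfl, rfl⟩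
  have hmem : ∀ g, ∃ L : List G, L.prod = g ∧ (L.map w).sum = sInf (S g) := fun g =>
    Nat.sInf_mem (hS g)
  have hone : sInf (S 1) = 0 := Nat.le_zero.1 (hle [])
  have hmul : ∀ g h, sInf (S (g * h)) ≤ sInf (S g) + sInf (S h) := fun g h => by
    obtain ⟨L, rfl, hL⟩ := hmem g
    obtain ⟨L', rfl, hL'⟩ := hmem h
    rw [← hL, ← hL', ← List.prod_append, ← List.sum_append, ← List.map_append]
    exact hle _
  have hinv : ∀ g, sInf (S g⁻¹) ≤ sInf (S g) := fun g => by
    obtain ⟨L, rfl, hL⟩ := hmem g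
    rw [← hL, List.prod_inv_reverse]
    refine (hle _).trans_eq ?_
    rw [List.map_reverse, List.sum_reverse, List.map_map]
    congr 1
    exact List.map_congr_left fun g _ => hw g
  have hzero : ∀ g, sInf (S g) = 0 → g = 1 := fun g hg => by
    obtain ⟨L, rfl, hL⟩ := hmem g
    cases L with
    | nil => rfl
    | cons a L =>
      rw [hg, List.map_cons, List.sum_cons] at hL
      simp [w] at hL
  have hfin : ∀ N : ℕ, {g | ∃ L : List G, L.prod = g ∧ (L.map w).sum ≤ N}.Finite := by
    intro N
    induction N with
    | zero =>
      refine (Set.finite_singleton (1 : G)).subset ?_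
      rintro _ ⟨L, rfl, hL⟩
      cases L with
      | nil => simp
      | cons a L => simp [w] at hL
    | succ N ih =>
      refine (((hwfin (N + 1)).image2 (· * ·) ih).insert 1).subset ?_
      rintro _ ⟨L, rfl, hL⟩
      cases L with
      | nil => simp
      | cons a L =>
        rw [List.map_cons, List.sum_cons] at hL
        have ha : 1 ≤ w a := Nat.le_add_left 1 _
        refine Or.inr ⟨a, ?_, L.prod, ⟨L, rfl, by omega⟩, by simp⟩
        change w a ≤ N + 1
        omega
  refine ⟨{ toFun := fun g => (sInf (S g) : ℕ)
            map_one' := by rw [hone, Nat.cast_zero]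
            mul_le' := fun g h => by exact_mod_cast hmul g h
            inv' := fun g => ?_
            eq_one_of_map_eq_zero' := fun g hg => hzero g (by exact_mod_cast hg)
            finite_ball := fun R => ?_ }⟩
  · have := hinv g⁻¹
    rw [inv_inv] at this
    exact_mod_cast le_antisymm (hinv g) this
  · refine (hfin ⌊R⌋₊).subset fun g hg => ?_
    obtain ⟨L, hL, hL'⟩ := hmem g
    exact ⟨L, hL, hL' ▸ Nat.le_floor hg⟩

theorem theorem1 (G : Type u) [Group G] [Countable G] (hG : IsResiduallyAmenable G) :
    (ActsProperlyOnUniformlyConvex G ↔ ∃ X : BoxFamily G, X.EmbedsInUniformlyConvex) ∧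
    (ActsProperlyOnUniformlyConvex G ↔ ∀ X : BoxFamily G, X.EmbedsInUniformlyConvex) := by
  obtain ⟨S⟩ := hG
  obtain ⟨l⟩ := nonempty_properLength G
  exact ⟨⟨fun h => ⟨⟨S, l⟩, h.embeds _⟩, fun ⟨_, hX⟩ => hX.actsProperly⟩,
    ⟨fun h => h.embeds, fun h => (h ⟨S, l⟩).actsProperly⟩⟩
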